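/- Let $X$ be a compact connected Riemann surface with holomorphic universal cover $p:\widetilde X\to X$ and deck transformation group $\Gamma\cong\pi_1(X)$. A \emph{branched affine structure} on $X$ is a non-constant holomorphic function $\mathrm{dev}:\widetilde X\to\mathbb{C}$ (the developing map) together with a homomorphism $\rho:\Gamma\to\mathrm{Aff}(\mathbb{C})$ (the holonomy) such that $\mathrm{dev}(\gamma\cdot y)=\rho(\gamma)(\mathrm{dev}(y))$ for all $\gamma\in\Gamma$, $y\in\widetilde X$. For $g\in\mathrm{Aff}(\mathbb{C})$, the pairs $(\mathrm{dev},\rho)$ and $(g\circ\mathrm{dev},\,g\rho g^{-1})$ define the same structure. It is a \emph{translation structure} (and $X$ with it a translation surface) if every $\rho(\gamma)$ is a translation. If $\mathcal{T}$ is a translation structure with developing map $h$ and holonomy $\gamma\mapsto(z\mapsto z+c(\gamma))$, its \emph{exponential} $\exp(\mathcal{T})$ is the branched affine structure with developing map $e^{h}$ and holonomy $\gamma\mapsto(z\mapsto e^{c(\gamma)}z)$. Let $\mathcal{A}$ be a branched affine structure on $X$ whose holonomy $\rho$ has abelian image. Then: (i) $(X,\mathcal{A})$ is not a translation surface if and only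 if there is a point of $\mathbb{C}$ fixed by every $\rho(\gamma)$, $\gamma\in\Gamma$; (ii) if $(X,\mathcal{A})$ is not a translation surface, then there exists a translation structure $\mathcal{T}$ on $X$ such that $\mathcal{A}$ and $\exp(\mathcal{T})$ are the same branched affine structure. -/

import Mathlib

open scoped Manifold ContDiff

/-- The group of deck transformations of a map `p : Y → X`: the self-homeomorphisms of `Y` over
`X`. When `p` is the universal cover of `X`, this is `π₁(X)` acting on `Y`. -/
def DeckGroup {X Y : Type*} [TopologicalSpace Y] (p : Y → X) : Subgroup (Y ≃ₜ Y) where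
  carrier := {γ | ∀ y, p (γ y) = p y}
  mul_mem' {a b} ha hb y := (ha (b y)).trans (hb y)
  one_mem' _ := rfl
  inv_mem' {a} ha y := by
    have h := ha (a⁻¹ y)
    have e : a (a⁻¹ y) = y := a.apply_symm_apply y
    rw [e] at h
    exact h.symm

/-- `p : Y → X` is the (holomorphic) universal covering of the Riemann surface `X`: `Y` is simply
connected and `p` is a holomorphic covering map. -/
structure IsUniversalCover {X Y : Type*} [TopologicalSpace X] [ChartedSpace ℂ X]
    [TopologicalSpace Y] [ChartedSpace ℂ Y] (p : Y → X) : Prop where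
  simplyConnected : SimplyConnectedSpace Y
  isCoveringMap : IsCoveringMap p
  holomorphic : MDifferentiable 𝓘(ℂ) 𝓘(ℂ) p

/-- A branched affine structure on `X`, where `p : Y → X` is the universal cover of `X`: a
non-constant holomorphic function `dev` on `Y` (the developing map) that is equivariant with respect
to a homomorphism `hol` from the deck group to `Aff(ℂ)` (the holonomy). -/
structure BranchedAffineStructure {X Y : Type*} [TopologicalSpace Y] [ChartedSpace ℂ Y]
    (p : Y → X) where
  dev : Y → ℂ
  hol : DeckGroup p →* (ℂ ≃ᵃ[ℂ] ℂ)
  holomorphic : MDifferentiable 𝓘(ℂ) 𝓘(ℂ) dev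
  nonconstant : ∃ x y, dev x ≠ dev y
  equivariant : ∀ (γ : DeckGroup p) (y : Y), dev (γ.1 y) = hol γ (dev y)

namespace BranchedAffineStructure

variable {X Y : Type*} [TopologicalSpace Y] [ChartedSpace ℂ Y] {p : Y → X}

/-- The developing pairs `A` and `B` define the same branched affine structure: they differ by
post-composition with an element of `Aff(ℂ)`. -/
def SameStructure (A B : BranchedAffineStructure p) : Prop :=
  ∃ g : ℂ ≃ᵃ[ℂ] ℂ, (∀ y, A.dev y = g (B.dev y)) ∧ ∀ γ, A.hol γ = g * B.hol γ * g⁻¹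

/-- The image of the holonomy is abelian. -/
def HasAbelianHolonomy (A : BranchedAffineStructure p) : Prop :=
  ∀ γ δ, A.hol γ * A.hol δ = A.hol δ * A.hol γ

/-- The structure is a translation surface: its holonomy consists of translations. -/
def IsTranslation (A : BranchedAffineStructure p) : Prop :=
  ∀ γ, ∃ c : ℂ, ∀ z, A.hol γ z = z + c

end BranchedAffineStructure

/-- A translation structure: a branched affine structure whose holonomy consists of translations,
with developing map given up to translations. -/
structure TranslationStructure {X Y : Type*} [TopologicalSpace Y] [ChartedSpace ℂ Y]
    (p : Y → X) extends BranchedAffineStructure p where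
  isTranslation : toBranchedAffineStructure.IsTranslation

namespace TranslationStructure

variable {X Y : Type*} [TopologicalSpace Y] [ChartedSpace ℂ Y] {p : Y → X}

/-- The translation vector of `γ`, that is the period of `dev` along `γ`. -/
noncomputable def period (T : TranslationStructure p) (γ : DeckGroup p) : ℂ := T.hol γ 0

theorem hol_apply (T : TranslationStructure p) (γ : DeckGroup p) (z : ℂ) :
    T.hol γ z = z + T.period γ := by
  obtain ⟨c, hc⟩ := T.isTranslation γ
  simp [period, hc]

theorem period_one (T : TranslationStructure p) : T.period 1 = 0 := by
  simp [period]

theorem period_mul (T : TranslationStructure p) (γ δ : DeckGroup p) :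
    T.period (γ * δ) = T.period γ + T.period δ := by
  have h : T.period (γ * δ) = T.hol γ (T.hol δ 0) := by simp [period]
  rw [h, T.hol_apply, T.hol_apply]
  ring

theorem exp_dev_nonconstant [ConnectedSpace Y] (T : TranslationStructure p) :
    ∃ x y, Complex.exp (T.dev x) ≠ Complex.exp (T.dev y) := by
  by_contra! h
  obtain ⟨x, y, hxy⟩ := T.nonconstant
  apply hxy
  have hpi : (2 * Real.pi * Complex.I : ℂ) ≠ 0 := Complex.two_pi_I_ne_zero
  let F : Y → ℂ := fun z => (T.dev z - T.dev x) / (2 * Real.pi * Complex.I)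
  have hF : Continuous F := (T.holomorphic.continuous.sub continuous_const).div_const _
  have hint : ∀ z, ∃ n : ℤ, F z = n := by
    intro z
    obtain ⟨n, hn⟩ := Complex.exp_eq_exp_iff_exists_int.1 (h z x)
    refine ⟨n, ?_⟩
    simp only [F, hn]
    field_simp
    ring
  choose n hn using hint
  have hnc : Continuous n := by
    have : Continuous fun z => ((n z : ℤ) : ℂ) := by
      simpa only [← hn] using hF
    exact (Int.isClosedEmbedding_coe_real.isEmbedding.continuous_iff).2
      (by simpa [Function.comp_def] using Complex.continuous_re.comp this)
  have hc : n x = n y := PreconnectedSpace.constant inferInstance hnc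
  have e : F x = F y := by rw [hn, hn, hc]
  have e2 : T.dev x - T.dev x = T.dev y - T.dev x := (div_left_inj' hpi).1 e
  exact (sub_left_inj.1 e2)

/-- The exponential `exp(T)` of a translation structure: the developing map is `exp ∘ dev`, and the
holonomy of `γ` is multiplication by `exp` of the period of `γ`. -/
noncomputable def exp [ConnectedSpace Y] (T : TranslationStructure p) :
    BranchedAffineStructure p where
  dev y := Complex.exp (T.dev y)
  hol :=
    { toFun := fun γ => AffineEquiv.homothetyUnitsMulHom (0 : ℂ)
        (Units.mk0 (Complex.exp (T.period γ)) (Complex.exp_ne_zero _))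
      map_one' := by
        ext z
        simp [T.period_one]
      map_mul' := fun γ δ => by
        ext z
        simp [AffineMap.homothety_apply, T.period_mul, Complex.exp_add] }
  holomorphic := Complex.differentiable_exp.mdifferentiable.comp T.holomorphic
  nonconstant := T.exp_dev_nonconstant
  equivariant γ y := by
    simp [AffineMap.homothety_apply, T.equivariant, T.hol_apply, Complex.exp_add, mul_comm]

end TranslationStructure

/-! If some holonomy δ is not a translation, its linear part differs from 1, so δ has exactly one
fixed point z₀; every holonomy map commutes with δ and hence fixes z₀
(`BranchedAffineStructure.exists_fixed`). Compactness enters in the converse and in (ii), through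
one fact: `dev` omits every point z₀ fixed by the holonomy (`IsUniversalCover.dev_ne_of_fixed`).
Then a translation holonomy with a fixed point would be trivial and fix the values of `dev` too,
which is absurd; and `dev - z₀` has a logarithm h on the simply connected cover, whose differences
h∘γ - h are constant, so h develops the required translation structure.

The omission holds because f = `dev - z₀` is multiplied by a constant under each deck
transformation, so it is a section of a flat line bundle, which has degree 0
(`FlatSection.ord_eq_zero`). The form dlog f descends to X. For a partition of unity P_i, locally
constant near the zeros, the pairing of ∂̄P_i with dlog f is -(order at i)·κ_i with κ_i > 0, by
Cauchy–Pompeiu. Since ∑ ∂̄P_i = ∂̄1 = 0, these numbers sum to 0, so every order is 0. Only the sign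
of κ_i matters, so its exact value is never computed. -/

section

open Complex Set Filter Topology MeasureTheory

/-! ### The operator ∂̄ on the plane -/

/-- Twice the Wirtinger derivative `∂h/∂z̄`. -/
noncomputable def dbar (h : ℂ → ℂ) (z : ℂ) : ℂ := fderiv ℝ h z 1 + I * fderiv ℝ h z I

theorem dbar_mul {h k : ℂ → ℂ} {z : ℂ} (hh : DifferentiableAt ℝ h z)
    (hk : DifferentiableAt ℝ k z) :
    dbar (fun w => h w * k w) z = dbar h z * k z + h z * dbar k z := by
  simp only [dbar, fderiv_fun_mul hh hk, add_apply, smul_apply, smul_eq_mul]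
  ring

theorem dbar_congr {h k : ℂ → ℂ} {z : ℂ} (e : h =ᶠ[𝓝 z] k) : dbar h z = dbar k z := by
  simp only [dbar, e.fderiv_eq]

theorem dbar_const (c z : ℂ) : dbar (fun _ => c) z = 0 := by
  simp [dbar]

theorem dbar_eq_zero_of_differentiableAt {h : ℂ → ℂ} {z : ℂ} (hh : DifferentiableAt ℂ h z) :
    dbar h z = 0 := by
  have e : fderiv ℝ h z = (fderiv ℂ h z).restrictScalars ℝ :=
    (hh.hasFDerivAt.restrictScalars ℝ).fderiv
  have e2 : fderiv ℂ h z I = I * fderiv ℂ h z 1 := by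
    simp
  simp only [dbar, e, ContinuousLinearMap.coe_restrictScalars', e2, ← mul_assoc, I_mul_I]
  ring

theorem dbar_sum {ι : Type*} (t : Finset ι) {h : ι → ℂ → ℂ} {z : ℂ}
    (hh : ∀ i ∈ t, DifferentiableAt ℝ (h i) z) :
    dbar (fun w => ∑ i ∈ t, h i w) z = ∑ i ∈ t, dbar (h i) z := by
  simp only [dbar, fderiv_fun_sum hh, sum_apply, Finset.sum_add_distrib,
    Finset.mul_sum]

theorem fderiv_real_apply (L : ℂ →L[ℝ] ℂ) (a : ℂ) : L a = a.re * L 1 + a.im * L I := by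
  conv_lhs => rw [← re_add_im a]
  have h1 : ((a.re : ℂ) + a.im * I) = a.re • (1 : ℂ) + a.im • I := by simp
  rw [h1, map_add, map_smul, map_smul]
  simp

theorem dbar_comp_of_differentiableAt {h τ : ℂ → ℂ} {z : ℂ} (hh : DifferentiableAt ℝ h (τ z))
    (hτ : DifferentiableAt ℂ τ z) :
    dbar (fun w => h (τ w)) z = (starRingEnd ℂ) (deriv τ z) * dbar h (τ z) := by
  have e : fderiv ℝ (fun w => h (τ w)) z
      = (fderiv ℝ h (τ z)).comp ((fderiv ℂ τ z).restrictScalars ℝ) :=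
    (hh.hasFDerivAt.comp z (hτ.hasFDerivAt.restrictScalars ℝ)).fderiv
  have e2 : fderiv ℂ τ z I = I * deriv τ z := by
    simp
  have e3 : fderiv ℂ τ z 1 = deriv τ z := fderiv_apply_one_eq_deriv
  simp only [dbar, e, ContinuousLinearMap.comp_apply, ContinuousLinearMap.coe_restrictScalars', e2,
    e3]
  rw [fderiv_real_apply _ (deriv τ z), fderiv_real_apply _ (I * deriv τ z)]
  set a := deriv τ z
  have e4 : (starRingEnd ℂ) a = a.re - a.im * I := by
    apply Complex.ext <;> simp
  rw [e4]
  simp only [mul_re, I_re, I_im, mul_im, zero_mul, one_mul, zero_sub, zero_add, ofReal_neg]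
  linear_combination (a.im * fderiv ℝ h (τ z) I) * I_mul_I

theorem continuous_dbar {h : ℂ → ℂ} (hh : ContDiff ℝ 1 h) : Continuous (dbar h) := by
  have := hh.continuous_fderiv one_ne_zero
  unfold dbar
  fun_prop

theorem continuousAt_dbar {h : ℂ → ℂ} {z : ℂ} (hh : ContDiffAt ℝ 1 h z) :
    ContinuousAt (dbar h) z := by
  have := hh.continuousAt_fderiv one_ne_zero
  unfold dbar
  fun_prop

theorem dbar_eq_zero_of_notMem_tsupport {h : ℂ → ℂ} {z : ℂ} (hz : z ∉ tsupport h) :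
    dbar h z = 0 := by
  rw [dbar_congr (notMem_tsupport_iff_eventuallyEq.1 hz)]
  exact dbar_const 0 z

theorem hasCompactSupport_dbar {h : ℂ → ℂ} (hc : HasCompactSupport h) :
    HasCompactSupport (dbar h) :=
  HasCompactSupport.intro hc fun _ hz => dbar_eq_zero_of_notMem_tsupport hz

/-! ### Integrals of ∂̄ against holomorphic and meromorphic functions -/

theorem integral_dbar_eq_zero {h : ℂ → ℂ} (hh : ContDiff ℝ 1 h) (hc : HasCompactSupport h) :
    ∫ z, dbar h z = 0 := by
  have hcont := hh.continuous_fderiv one_ne_zero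
  have hint : ∀ v, Integrable (fun z => fderiv ℝ h z v) := fun v =>
    (by fun_prop : Continuous fun z => fderiv ℝ h z v).integrable_of_hasCompactSupport
      (hc.fderiv_apply ℝ v)
  have hz : ∀ v, ∫ z, fderiv ℝ h z v = 0 := by
    intro v
    have := integral_mul_fderiv_eq_neg_fderiv_mul_of_integrable (μ := (volume : Measure ℂ))
      (f := fun _ => (1 : ℂ)) (g := h) (v := v) (by simp) (by simpa using hint v)
      (by simpa using hh.continuous.integrable_of_hasCompactSupport hc)
      (fun _ _ => differentiableAt_const _)
      (fun _ _ => (hh.differentiable one_ne_zero).differentiableAt)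
    simpa using this
  unfold dbar
  rw [integral_add (hint 1) ((hint I).const_mul I), integral_const_mul, hz, hz]
  simp

/-- Pairing `∂̄φ` with a function holomorphic on a neighbourhood of the support gives zero. -/
theorem integral_dbar_mul_eq_zero {φ q : ℂ → ℂ} (hφ : ContDiff ℝ 1 φ) (hc : HasCompactSupport φ)
    (hq : ∀ z ∈ tsupport φ, AnalyticAt ℂ q z) : ∫ z, dbar φ z * q z = 0 := by
  have hprod : ContDiff ℝ 1 fun z => φ z * q z := by
    rw [contDiff_iff_contDiffAt]
    intro z
    by_cases hz : z ∈ tsupport φ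
    · exact hφ.contDiffAt.mul ((hq z hz).contDiffAt.restrict_scalars ℝ)
    · have : (fun z => φ z * q z) =ᶠ[𝓝 z] fun _ => 0 := by
        filter_upwards [notMem_tsupport_iff_eventuallyEq.1 hz] with w hw
        simp [hw]
      exact contDiffAt_const.congr_of_eventuallyEq this
  have h0 := integral_dbar_eq_zero hprod hc.mul_right
  rw [← h0]
  congr 1
  ext z
  by_cases hz : z ∈ tsupport φ
  · have hd := (hq z hz).differentiableAt
    rw [dbar_mul (hφ.differentiable one_ne_zero).differentiableAt (hd.restrictScalars ℝ),
      dbar_eq_zero_of_differentiableAt hd]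
    ring
  · rw [dbar_eq_zero_of_notMem_tsupport hz, dbar_eq_zero_of_notMem_tsupport
      (fun h => hz (tsupport_mul_subset_left h)), zero_mul]

/-- The factor `z - z₀` cancels the Cauchy kernel exactly, leaving a real density of constant sign
when `g` is monotone. -/
theorem dbar_comp_norm_sub_sq {g : ℝ → ℝ} {g' : ℝ} {z₀ z : ℂ}
    (hg : HasDerivAt g g' (‖z - z₀‖ ^ 2)) :
    dbar (fun w => (g (‖w - z₀‖ ^ 2) : ℂ)) z = 2 * g' * (z - z₀) := by
  have h1 : HasFDerivAt (fun w : ℂ => ‖w - z₀‖ ^ 2) _ z :=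
    ((hasFDerivAt_id (𝕜 := ℝ) z).sub_const z₀).norm_sq
  have h2 := ofRealCLM.hasFDerivAt.comp z (hg.comp_hasFDerivAt z h1)
  have h3 : fderiv ℝ (fun w => (g (‖w - z₀‖ ^ 2) : ℂ)) z = _ := h2.fderiv
  simp only [dbar, h3]
  simp
  apply Complex.ext <;> simp <;> ring

/-- A qualitative form of the Cauchy–Pompeiu formula: the pairing of `∂̄φ` with the Cauchy
kernel is a negative real number when `φ = 1` near the pole. -/
theorem exists_integral_dbar_mul_inv_eq_neg {φ : ℂ → ℂ} {z₀ : ℂ} (hφ : ContDiff ℝ 1 φ)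
    (hc : HasCompactSupport φ) (h1 : ∀ᶠ z in 𝓝 z₀, φ z = 1) :
    ∃ κ : ℝ, 0 < κ ∧ ∫ z, dbar φ z * (z - z₀)⁻¹ = -κ := by
  obtain ⟨R, hR, hball⟩ := Metric.eventually_nhds_iff_ball.1 h1
  -- The cutoff `g` rises from 0 to 1 for squared distances between `d` and `2 * d = R ^ 2 / 2`,
  -- inside the ball where `φ = 1`.
  set d : ℝ := R ^ 2 / 4 with hd
  have hd0 : 0 < d := by positivity
  have hsmooth : ContDiff ℝ 1 Real.smoothTransition := Real.smoothTransition.contDiff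
  set g : ℝ → ℝ := fun s => Real.smoothTransition (s / d - 1) with hg
  have hgs : ContDiff ℝ 1 g := hsmooth.comp (by fun_prop)
  have hgd : ∀ s, HasDerivAt g (deriv g s) s := fun s =>
    (hgs.differentiable one_ne_zero s).hasDerivAt
  have hg0 : ∀ s, s ≤ d → g s = 0 := fun s hs =>
    Real.smoothTransition.zero_of_nonpos (by rw [sub_nonpos, div_le_one hd0]; exact hs)
  have hg1 : ∀ s, 2 * d ≤ s → g s = 1 := fun s hs =>
    Real.smoothTransition.one_of_one_le (by rw [le_sub_iff_add_le, le_div_iff₀ hd0]; linarith)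
  have hg0' : ∀ s, s < d → deriv g s = 0 := fun s hs => by
    have : g =ᶠ[𝓝 s] fun _ => 0 := by
      filter_upwards [Iio_mem_nhds hs] with t ht using hg0 t (le_of_lt ht)
    rw [this.deriv_eq, deriv_const]
  have hg1' : ∀ s, 2 * d < s → deriv g s = 0 := fun s hs => by
    have : g =ᶠ[𝓝 s] fun _ => 1 := by
      filter_upwards [Ioi_mem_nhds hs] with t ht using hg1 t (le_of_lt ht)
    rw [this.deriv_eq, deriv_const]
  have hgm : Monotone g := fun s t hst => Real.smoothTransition.monotone (by gcongr)
  set D : ℂ → ℝ := fun z => 2 * deriv g (‖z - z₀‖ ^ 2) with hD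
  have hDc : Continuous D := by
    have := hgs.continuous_deriv le_rfl
    fun_prop
  have hDs : HasCompactSupport D := by
    refine HasCompactSupport.intro (isCompact_closedBall z₀ R) fun z hz => ?_
    have : R < ‖z - z₀‖ := by simpa [dist_eq_norm] using hz
    simp only [hD, hg1' (‖z - z₀‖ ^ 2) (by rw [hd]; nlinarith), mul_zero]
  have hDpos : 0 < ∫ z, D z := by
    have hD0 : 0 ≤ D := fun z => mul_nonneg zero_le_two hgm.deriv_nonneg
    -- By the mean value theorem `g'` is positive somewhere, which makes the integral of `D`
    -- strictly positive.
    obtain ⟨s, ⟨hs1, -⟩, hs⟩ := exists_deriv_eq_slope g (by linarith : d < 2 * d)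
      hgs.continuous.continuousOn (hgs.differentiable one_ne_zero).differentiableOn
    refine hDc.integral_pos_of_hasCompactSupport_nonneg_nonzero hDs hD0
      (x := z₀ + (Real.sqrt s : ℂ)) ?_
    have hss : ‖z₀ + (Real.sqrt s : ℂ) - z₀‖ ^ 2 = s := by
      rw [add_sub_cancel_left, norm_real, Real.norm_eq_abs, sq_abs, Real.sq_sqrt (by linarith)]
    simp only [hD, hss, hs, hg1 (2 * d) le_rfl, hg0 d le_rfl]
    have : 2 * d - d ≠ 0 := by linarith
    positivity
  -- Cutting off the kernel near its pole makes `H` a compactly supported C¹ function, so `dbar H`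
  -- integrates to 0; the error made by the cutoff is exactly `D`.
  set H : ℂ → ℂ := fun z => φ z * ((z - z₀)⁻¹ * (g (‖z - z₀‖ ^ 2) : ℂ)) with hH
  have hnear : ∀ z, ‖z - z₀‖ ^ 2 < d → H =ᶠ[𝓝 z] fun _ => 0 := by
    intro z hz
    have : ∀ᶠ w in 𝓝 z, ‖w - z₀‖ ^ 2 < d :=
      (by fun_prop : Continuous fun w : ℂ => ‖w - z₀‖ ^ 2).continuousAt.eventually_lt
        continuousAt_const hz
    filter_upwards [this] with w hw
    simp [hH, hg0 _ hw.le]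
  have hne : ∀ z, ¬ ‖z - z₀‖ ^ 2 < d → z - z₀ ≠ 0 := by
    intro z hz h
    apply hz
    simpa [h] using hd0
  have hgz : ContDiff ℝ 1 fun w : ℂ => (g (‖w - z₀‖ ^ 2) : ℂ) :=
    ofRealCLM.contDiff.comp (hgs.comp ((contDiff_id.sub contDiff_const).norm_sq ℝ))
  have hinv : ∀ z, z - z₀ ≠ 0 → AnalyticAt ℂ (fun w => (w - z₀)⁻¹) z := fun z hz =>
    (analyticAt_id.sub analyticAt_const).inv hz
  have hHs : ContDiff ℝ 1 H := by
    rw [contDiff_iff_contDiffAt]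
    intro z
    by_cases hz : ‖z - z₀‖ ^ 2 < d
    · exact contDiffAt_const.congr_of_eventuallyEq (hnear z hz)
    · exact hφ.contDiffAt.mul
        (((hinv z (hne z hz)).contDiffAt.restrict_scalars ℝ).mul hgz.contDiffAt)
  have hHc : HasCompactSupport H := hc.mul_right
  have key : ∀ z, dbar φ z * (z - z₀)⁻¹ = dbar H z - D z := by
    intro z
    have hφ0 : ‖z - z₀‖ ^ 2 ≤ 2 * d → φ z = 1 ∧ dbar φ z = 0 := by
      intro h
      have hzb : z ∈ Metric.ball z₀ R := by
        rw [Metric.mem_ball, dist_eq_norm]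
        nlinarith [norm_nonneg (z - z₀)]
      refine ⟨hball z hzb, ?_⟩
      have : φ =ᶠ[𝓝 z] fun _ => 1 := by
        filter_upwards [Metric.isOpen_ball.mem_nhds hzb] with w hw using hball w hw
      rw [dbar_congr this, dbar_const]
    by_cases hz : ‖z - z₀‖ ^ 2 < d
    · rw [(hφ0 (by linarith)).2, dbar_congr (hnear z hz), dbar_const]
      simp [hD, hg0' _ hz]
    · have hz0 := hne z hz
      have hdi := (hinv z hz0).differentiableAt
      have hgd1 := (hgz.differentiable one_ne_zero) z
      have hdi' : DifferentiableAt ℝ (fun w => (w - z₀)⁻¹) z := hdi.restrictScalars ℝ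
      rw [hH, dbar_mul ((hφ.differentiable one_ne_zero) z) (hdi'.fun_mul hgd1), dbar_mul (hdi.restrictScalars ℝ) hgd1,
        dbar_eq_zero_of_differentiableAt hdi, dbar_comp_norm_sub_sq (hgd _)]
      simp only [hD, ofReal_mul, ofReal_ofNat]
      by_cases hz2 : ‖z - z₀‖ ^ 2 ≤ 2 * d
      · rw [(hφ0 hz2).1, (hφ0 hz2).2]
        field_simp
        ring
      · rw [hg1 _ (le_of_not_ge hz2), hg1' _ (lt_of_not_ge hz2)]
        simp
  refine ⟨∫ z, D z, hDpos, ?_⟩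
  simp only [key]
  rw [integral_sub, integral_dbar_eq_zero hHs hHc, zero_sub]
  · exact congrArg Neg.neg integral_ofReal
  · exact (continuous_dbar hHs).integrable_of_hasCompactSupport (hasCompactSupport_dbar hHc)
  · exact (hDc.integrable_of_hasCompactSupport hDs).ofReal

/-- The logarithmic derivative splits as n/(z - z₀) plus that of `g`. The latter is holomorphic on
the support and contributes 0; the former gives the Cauchy–Pompeiu term. -/
theorem integral_dbar_mul_logDeriv {φ g : ℂ → ℂ} {z₀ : ℂ} {n : ℕ} (hφ : ContDiff ℝ 1 φ)
    (hc : HasCompactSupport φ) (h1 : n ≠ 0 → ∀ᶠ z in 𝓝 z₀, φ z = 1)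
    (hg : ∀ z ∈ tsupport φ, AnalyticAt ℂ g z ∧ g z ≠ 0) :
    ∃ κ : ℝ, 0 < κ ∧ ∫ z, dbar φ z * logDeriv (fun w => (w - z₀) ^ n * g w) z = -(n * κ) := by
  have hq : ∀ z ∈ tsupport φ, AnalyticAt ℂ (logDeriv g) z := fun z hz =>
    (hg z hz).1.deriv.div (hg z hz).1 (hg z hz).2
  have e2 := integral_dbar_mul_eq_zero hφ hc hq
  rcases eq_or_ne n 0 with rfl | hn
  · exact ⟨1, one_pos, by simpa using e2⟩
  specialize h1 hn
  obtain ⟨κ, hκ, e⟩ := exists_integral_dbar_mul_inv_eq_neg hφ hc h1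
  refine ⟨κ, hκ, ?_⟩
  have key : ∀ z, dbar φ z * logDeriv (fun w => (w - z₀) ^ n * g w) z =
      n * (dbar φ z * (z - z₀)⁻¹) + dbar φ z * logDeriv g z := by
    intro z
    by_cases hz : z ∈ tsupport φ
    -- At the pole `dbar φ` vanishes, so the default value of the inverse there is harmless.
    · by_cases hz0 : z = z₀
      · have : φ =ᶠ[𝓝 z] fun _ => 1 := by rw [hz0]; exact h1
        rw [dbar_congr this, dbar_const]
        simp
      · have hz1 := sub_ne_zero.2 hz0
        rw [logDeriv_mul (f := fun w => (w - z₀) ^ n) z (pow_ne_zero n hz1) (hg z hz).2 (by fun_prop)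
          (hg z hz).1.differentiableAt]
        have : logDeriv (fun w => (w - z₀) ^ n) z = n * (z - z₀)⁻¹ := by
          have := logDeriv_fun_pow (f := fun w => w - z₀) (x := z) (by fun_prop) n
          rw [this, logDeriv_apply]
          simp
        rw [this]
        ring
    · simp [dbar_eq_zero_of_notMem_tsupport hz]
  simp only [key]
  -- A non-integrable function would have integral 0 by convention, contradicting `κ > 0`.
  have i1 : Integrable fun z => dbar φ z * (z - z₀)⁻¹ := by
    by_contra hi
    rw [integral_undef hi] at e
    have : κ = 0 := by exact_mod_cast (neg_eq_zero.1 e.symm)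
    exact hκ.ne' this
  have i2 : Integrable fun z => dbar φ z * logDeriv g z := by
    refine Continuous.integrable_of_hasCompactSupport ?_ (hasCompactSupport_dbar hc).mul_right
    rw [continuous_iff_continuousAt]
    intro z
    by_cases hz : z ∈ tsupport φ
    · exact (continuous_dbar hφ).continuousAt.mul (hq z hz).continuousAt
    · have : (fun z => dbar φ z * logDeriv g z) =ᶠ[𝓝 z] fun _ => 0 := by
        filter_upwards [(isClosed_tsupport φ).isOpen_compl.mem_nhds hz] with w hw
        simp [dbar_eq_zero_of_notMem_tsupport hw]
      exact continuousAt_const.congr this.symm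
  rw [integral_add (i1.const_mul _) i2, e2, integral_const_mul, e]
  ring

/-! ### Charts and coordinate changes -/

section ChartedSpace

variable {X : Type*} [TopologicalSpace X] [ChartedSpace ℂ X]

/-- The coordinate change between the preferred charts at `x` and `x'`. -/
noncomputable def coordChange (x x' : X) (z : ℂ) : ℂ := chartAt ℂ x' ((chartAt ℂ x).symm z)

theorem contDiffAt_coordChange [IsManifold 𝓘(ℂ) ω X] {x x' y : X}
    (hy : y ∈ (chartAt ℂ x).source) (hy' : y ∈ (chartAt ℂ x').source) :
    ContDiffAt ℂ ω (coordChange x x') (chartAt ℂ x y) := by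
  have h := contDiffOn_ext_coord_change (I := 𝓘(ℂ)) (n := ω) x' x
  have hs : IsOpen ((chartAt ℂ x).symm.trans (chartAt ℂ x')).source :=
    ((chartAt ℂ x).symm.trans (chartAt ℂ x')).open_source
  have hmem : chartAt ℂ x y ∈ ((chartAt ℂ x).symm.trans (chartAt ℂ x')).source := by
    simp [hy, hy']
  refine ContDiffOn.contDiffAt (s := ((chartAt ℂ x).symm.trans (chartAt ℂ x')).source)
    ?_ (hs.mem_nhds hmem)
  have e : coordChange x x' = fun z => chartAt ℂ x' ((chartAt ℂ x).symm z) := rfl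
  simpa [e, Function.comp_def, extChartAt] using h

/-- A complex-analytic atlas is a real-smooth atlas. -/
theorem isManifold_real_of_complex [IsManifold 𝓘(ℂ) ω X] : IsManifold 𝓘(ℝ, ℂ) ∞ X := by
  refine isManifold_of_contDiffOn _ _ _ fun e e' he he' => ?_
  have h : e.symm.trans e' ∈ contDiffGroupoid ω 𝓘(ℂ) :=
    HasGroupoid.compatible he he'
  have h2 : ContDiffOn ℂ ω (e' ∘ e.symm) (e.symm.trans e').source := by
    rw [contDiffGroupoid, mem_groupoid_of_pregroupoid] at h
    simpa [contDiffPregroupoid] using h.1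
  simpa using (h2.of_le le_top).restrict_scalars ℝ

theorem eventually_chartAt_symm {x y : X} (hy : y ∈ (chartAt ℂ x).source) {q : X → Prop}
    (h : ∀ᶠ w in 𝓝 y, q w) : ∀ᶠ z in 𝓝 (chartAt ℂ x y), q ((chartAt ℂ x).symm z) := by
  have := (chartAt ℂ x).continuousAt_symm ((chartAt ℂ x).map_source hy)
  rw [ContinuousAt, (chartAt ℂ x).left_inv hy] at this
  exact this h

theorem isOpen_chartAt_image {x : X} {s : Set X} (hs : IsOpen s)
    (h : s ⊆ (chartAt ℂ x).source) : IsOpen (chartAt ℂ x '' s) :=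
  (chartAt ℂ x).isOpen_image_of_subset_source hs h

theorem contDiffAt_chartAt_symm {φ : X → ℂ} [IsManifold 𝓘(ℝ, ℂ) ∞ X]
    (hφ : ContMDiff 𝓘(ℝ, ℂ) 𝓘(ℝ, ℂ) ∞ φ) {x y : X} (hy : y ∈ (chartAt ℂ x).source) :
    ContDiffAt ℝ 1 (fun w => φ ((chartAt ℂ x).symm w)) (chartAt ℂ x y) := by
  have h1 := contMDiffOn_chart_symm (I := 𝓘(ℝ, ℂ)) (n := ∞) (x := x)
  have h2 := (hφ.comp_contMDiffOn h1).contMDiffAt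
    ((chartAt ℂ x).open_target.mem_nhds ((chartAt ℂ x).map_source hy))
  exact h2.contDiffAt.of_le (by norm_num)

/-! ### Flat sections and their logarithmic differential -/

variable (X) in
/-- Local data for a holomorphic section of a flat line bundle: near each point `x` a holomorphic
function `sec x`, with at most one zero, located at `x`, such that any two of these are locally
proportional on their common domain. -/
structure FlatSection where
  sec : X → X → ℂ
  dom : X → Set X
  ord : X → ℕ
  unit : X → ℂ → ℂ
  isOpen_dom : ∀ x, IsOpen (dom x)
  mem_dom : ∀ x, x ∈ dom x
  dom_subset : ∀ x, dom x ⊆ (chartAt ℂ x).source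
  analyticAt_unit : ∀ x, ∀ y ∈ dom x, AnalyticAt ℂ (unit x) (chartAt ℂ x y)
  unit_ne_zero : ∀ x, ∀ y ∈ dom x, unit x (chartAt ℂ x y) ≠ 0
  sec_eq : ∀ x, ∀ y ∈ dom x,
    sec x y = (chartAt ℂ x y - chartAt ℂ x x) ^ ord x * unit x (chartAt ℂ x y)
  proportional : ∀ x x' y, y ∈ dom x → y ∈ dom x' →
    ∃ c : ℂ, c ≠ 0 ∧ ∀ᶠ w in 𝓝 y, sec x w = c * sec x' w

namespace FlatSection

variable (D : FlatSection X)

/-- The coefficient of the logarithmic differential of the section in the chart at `x`. -/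
noncomputable def dlog (x : X) : ℂ → ℂ := logDeriv fun w => D.sec x ((chartAt ℂ x).symm w)

/-- The coefficient of the `(1,1)`-form `ψ ∂̄φ ∧ dlog` in the chart at `x`. -/
noncomputable def density (ψ φ : X → ℂ) (x : X) (z : ℂ) : ℂ :=
  ψ ((chartAt ℂ x).symm z) * dbar (fun w => φ ((chartAt ℂ x).symm w)) z * D.dlog x z

theorem sec_symm_eventuallyEq {x y : X} (hy : y ∈ D.dom x) :
    (fun w => D.sec x ((chartAt ℂ x).symm w)) =ᶠ[𝓝 (chartAt ℂ x y)]
      fun w => (w - chartAt ℂ x x) ^ D.ord x * D.unit x w := by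
  have hys := D.dom_subset x hy
  filter_upwards [eventually_chartAt_symm hys ((D.isOpen_dom x).mem_nhds hy),
    (chartAt ℂ x).open_target.mem_nhds ((chartAt ℂ x).map_source hys)] with w hw hwt
  rw [D.sec_eq x _ hw, (chartAt ℂ x).right_inv hwt]

theorem analyticAt_sec {x y : X} (hy : y ∈ D.dom x) :
    AnalyticAt ℂ (fun w => D.sec x ((chartAt ℂ x).symm w)) (chartAt ℂ x y) :=
  (((analyticAt_id.sub analyticAt_const).pow _).mul (D.analyticAt_unit x y hy)).congr
    (D.sec_symm_eventuallyEq hy).symm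

theorem sec_ne_zero {x y : X} (hy : y ∈ D.dom x) (h : y = x → D.ord x = 0) : D.sec x y ≠ 0 := by
  rw [D.sec_eq x y hy]
  refine mul_ne_zero ?_ (D.unit_ne_zero x y hy)
  by_cases hyx : y = x
  · simp [h hyx]
  · refine pow_ne_zero _ (sub_ne_zero.2 fun e => hyx ?_)
    exact (chartAt ℂ x).injOn (D.dom_subset x hy) (mem_chart_source ℂ x) e

/-- Proportionality carries a zero at `x` over to `sec x'`, whose only possible zero is `x'`. Thus a
zero lies in no domain but its own. -/
theorem eq_of_mem_dom {x x' : X} (h0 : D.ord x ≠ 0) (h : x ∈ D.dom x') : x = x' := by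
  by_contra hne
  obtain ⟨c, hc, e⟩ := D.proportional x x' x (D.mem_dom x) h
  have e0 := e.self_of_nhds
  rw [D.sec_eq x x (D.mem_dom x), sub_self, zero_pow h0, zero_mul] at e0
  exact mul_ne_zero hc (D.sec_ne_zero h fun e => absurd e hne) e0.symm

/-- The constant of proportionality disappears in the logarithmic derivative, so the local data glue
to a global meromorphic 1-form. -/
theorem dlog_eq [IsManifold 𝓘(ℂ) ω X] {x x' y : X} (hy : y ∈ D.dom x) (hy' : y ∈ D.dom x') :
    D.dlog x (chartAt ℂ x y) =
      D.dlog x' (chartAt ℂ x' y) * deriv (coordChange x x') (chartAt ℂ x y) := by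
  have hys := D.dom_subset x hy
  have hys' := D.dom_subset x' hy'
  obtain ⟨c, hc, e⟩ := D.proportional x x' y hy hy'
  have hval : coordChange x x' (chartAt ℂ x y) = chartAt ℂ x' y := by
    rw [coordChange, (chartAt ℂ x).left_inv hys]
  have e2 : (fun w => D.sec x ((chartAt ℂ x).symm w)) =ᶠ[𝓝 (chartAt ℂ x y)]
      fun w => c * ((fun v => D.sec x' ((chartAt ℂ x').symm v)) ∘ coordChange x x') w := by
    filter_upwards [eventually_chartAt_symm hys e, eventually_chartAt_symm hys
      ((chartAt ℂ x').open_source.mem_nhds hys')] with w hw hw'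
    rw [hw, Function.comp_apply, coordChange, (chartAt ℂ x').left_inv hw']
  have e3 : D.dlog x (chartAt ℂ x y) = logDeriv (fun w => c *
      ((fun v => D.sec x' ((chartAt ℂ x').symm v)) ∘ coordChange x x') w) (chartAt ℂ x y) := by
    have e4 := e2.self_of_nhds
    simp only at e4
    rw [dlog, logDeriv_apply, logDeriv_apply, e2.deriv_eq, e4]
  rw [e3, logDeriv_const_mul _ _ hc, logDeriv_comp, hval]
  · rfl
  · rw [hval]
    exact (D.analyticAt_sec hy').differentiableAt
  · exact (contDiffAt_coordChange hys hys').differentiableAt (by simp)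

/-- With τ the coordinate change, ∂̄ contributes the conjugate of τ' and dlog contributes τ'; their
product |τ'|² is the real Jacobian needed for the change of variables. -/
theorem density_eq [IsManifold 𝓘(ℂ) ω X] {ψ φ : X → ℂ} {x x' y : X} (hy : y ∈ D.dom x)
    (hy' : y ∈ D.dom x')
    (hφ : DifferentiableAt ℝ (fun w => φ ((chartAt ℂ x').symm w)) (chartAt ℂ x' y)) :
    D.density ψ φ x (chartAt ℂ x y) =
      normSq (deriv (coordChange x x') (chartAt ℂ x y)) * D.density ψ φ x' (chartAt ℂ x' y) := by
  have hys := D.dom_subset x hy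
  have hys' := D.dom_subset x' hy'
  have hval : coordChange x x' (chartAt ℂ x y) = chartAt ℂ x' y := by
    rw [coordChange, (chartAt ℂ x).left_inv hys]
  have e : (fun w => φ ((chartAt ℂ x).symm w)) =ᶠ[𝓝 (chartAt ℂ x y)]
      fun w => (fun v => φ ((chartAt ℂ x').symm v)) (coordChange x x' w) := by
    filter_upwards [eventually_chartAt_symm hys
      ((chartAt ℂ x').open_source.mem_nhds hys')] with w hw
    rw [coordChange, (chartAt ℂ x').left_inv hw]
  have hd : DifferentiableAt ℂ (coordChange x x') (chartAt ℂ x y) :=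
    (contDiffAt_coordChange hys hys').differentiableAt (by simp)
  rw [density, density, dbar_congr e, dbar_comp_of_differentiableAt
    (h := fun v => φ ((chartAt ℂ x').symm v)) (by rwa [hval]) hd, hval,
    D.dlog_eq hy hy', (chartAt ℂ x).left_inv hys, (chartAt ℂ x').left_inv hys',
    normSq_eq_conj_mul_self]
  ring

theorem setIntegral_density_eq [IsManifold 𝓘(ℂ) ω X] {ψ φ : X → ℂ} {x x' : X}
    (hφ : ∀ y ∈ D.dom x',
      DifferentiableAt ℝ (fun w => φ ((chartAt ℂ x').symm w)) (chartAt ℂ x' y)) :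
    ∫ z in chartAt ℂ x '' (D.dom x ∩ D.dom x'), D.density ψ φ x z =
      ∫ z in chartAt ℂ x' '' (D.dom x ∩ D.dom x'), D.density ψ φ x' z := by
  have himg : coordChange x x' '' (chartAt ℂ x '' (D.dom x ∩ D.dom x')) =
      chartAt ℂ x' '' (D.dom x ∩ D.dom x') := by
    rw [image_image]
    refine image_congr fun y hy => ?_
    rw [coordChange, (chartAt ℂ x).left_inv (D.dom_subset x hy.1)]
  have hmeas : MeasurableSet (chartAt ℂ x '' (D.dom x ∩ D.dom x')) :=
    (isOpen_chartAt_image ((D.isOpen_dom x).inter (D.isOpen_dom x'))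
      (inter_subset_left.trans (D.dom_subset x))).measurableSet
  have hinj : InjOn (coordChange x x') (chartAt ℂ x '' (D.dom x ∩ D.dom x')) := by
    rintro _ ⟨y, hy, rfl⟩ _ ⟨y', hy', rfl⟩ h
    rw [coordChange, coordChange, (chartAt ℂ x).left_inv (D.dom_subset x hy.1),
      (chartAt ℂ x).left_inv (D.dom_subset x hy'.1)] at h
    rw [(chartAt ℂ x').injOn (D.dom_subset x' hy.2) (D.dom_subset x' hy'.2) h]
  rw [← himg, integral_image_eq_integral_abs_det_fderiv_smul volume hmeas
    (f' := fun z => (fderiv ℂ (coordChange x x') z).restrictScalars ℝ) ?_ hinj]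
  · refine setIntegral_congr_fun hmeas ?_
    rintro _ ⟨y, hy, rfl⟩
    have hval : coordChange x x' (chartAt ℂ x y) = chartAt ℂ x' y := by
      rw [coordChange, (chartAt ℂ x).left_inv (D.dom_subset x hy.1)]
    simp only
    rw [D.density_eq hy.1 hy.2 (hφ y hy.2), hval]
    have : (ContinuousLinearMap.restrictScalars ℝ
        (fderiv ℂ (coordChange x x') (chartAt ℂ x y))).det =
        normSq (deriv (coordChange x x') (chartAt ℂ x y)) := by
      simp [ContinuousLinearMap.det, LinearMap.det_restrictScalars, Algebra.norm_complex_eq]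
    rw [this, abs_of_nonneg (normSq_nonneg _), real_smul]
  · rintro _ ⟨y, hy, rfl⟩
    exact (((contDiffAt_coordChange (D.dom_subset x hy.1) (D.dom_subset x' hy.2)).differentiableAt
      (by simp)).hasFDerivAt.restrictScalars ℝ).hasFDerivWithinAt

theorem exists_integral_density_one [CompactSpace X] {φ : X → ℂ} {x : X}
    (hφ : ∀ y ∈ D.dom x,
      ContDiffAt ℝ 1 (fun w => φ ((chartAt ℂ x).symm w)) (chartAt ℂ x y))
    (hs : tsupport φ ⊆ D.dom x) (h1 : D.ord x ≠ 0 → ∀ᶠ y in 𝓝 x, φ y = 1) :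
    ∃ κ : ℝ, 0 < κ ∧ ∫ z in chartAt ℂ x '' D.dom x, D.density 1 φ x z = -(D.ord x * κ) := by
  set V := chartAt ℂ x '' D.dom x with hV
  have hVo : IsOpen V := isOpen_chartAt_image (D.isOpen_dom x) (D.dom_subset x)
  -- Outside the chart image the inverse chart has no meaning, so `φ` is extended by 0; the support
  -- condition keeps the extension C¹.
  set Φ : ℂ → ℂ := V.indicator fun w => φ ((chartAt ℂ x).symm w) with hΦ
  have hcl : IsCompact (tsupport φ) := (isClosed_tsupport φ).isCompact
  have hK : IsCompact (chartAt ℂ x '' tsupport φ) :=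
    hcl.image_of_continuousOn ((chartAt ℂ x).continuousOn.mono (hs.trans (D.dom_subset x)))
  have hsupp : Function.support Φ ⊆ chartAt ℂ x '' tsupport φ := by
    intro z hz
    have hzV : z ∈ V := by
      by_contra h
      exact hz (indicator_of_notMem h _)
    have hz' : φ ((chartAt ℂ x).symm z) ≠ 0 := by
      have := Function.mem_support.1 hz
      rwa [hΦ, indicator_of_mem hzV] at this
    obtain ⟨y, hy, rfl⟩ := hzV
    rw [(chartAt ℂ x).left_inv (D.dom_subset x hy)] at hz'
    exact ⟨y, subset_tsupport φ hz', rfl⟩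
  have htsupp : tsupport Φ ⊆ chartAt ℂ x '' tsupport φ := closure_minimal hsupp hK.isClosed
  have hΦeq : ∀ z ∈ V, Φ =ᶠ[𝓝 z] fun w => φ ((chartAt ℂ x).symm w) := fun z hz => by
    filter_upwards [hVo.mem_nhds hz] with w hw using indicator_of_mem hw _
  have hΦs : ContDiff ℝ 1 Φ := by
    rw [contDiff_iff_contDiffAt]
    intro z
    by_cases hz : z ∈ V
    · refine ContDiffAt.congr_of_eventuallyEq ?_ (hΦeq z hz)
      obtain ⟨y, hy, rfl⟩ := hz
      exact hφ y hy
    · have : z ∉ tsupport Φ := fun h => hz (image_mono hs (htsupp h))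
      exact contDiffAt_const.congr_of_eventuallyEq (notMem_tsupport_iff_eventuallyEq.1 this)
  have hΦ1 : D.ord x ≠ 0 → ∀ᶠ z in 𝓝 (chartAt ℂ x x), Φ z = 1 := fun h => by
    filter_upwards [hΦeq _ (mem_image_of_mem _ (D.mem_dom x)),
      eventually_chartAt_symm (mem_chart_source ℂ x) (h1 h)] with z hz hz1
    rw [hz, hz1]
  obtain ⟨κ, hκ, e⟩ := integral_dbar_mul_logDeriv (g := D.unit x) hΦs
    (HasCompactSupport.of_support_subset_isCompact hK hsupp) hΦ1 (by
      intro z hz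
      obtain ⟨y, hy, rfl⟩ := htsupp hz
      exact ⟨D.analyticAt_unit x y (hs hy), D.unit_ne_zero x y (hs hy)⟩)
  refine ⟨κ, hκ, ?_⟩
  have hout : ∀ z, z ∉ V → dbar Φ z *
      logDeriv (fun w => (w - chartAt ℂ x x) ^ D.ord x * D.unit x w) z = 0 := fun z hz => by
    rw [dbar_eq_zero_of_notMem_tsupport fun h => hz (image_mono hs (htsupp h)), zero_mul]
  rw [← e, ← setIntegral_eq_integral_of_forall_compl_eq_zero hout]
  refine setIntegral_congr_fun hVo.measurableSet fun z hz => ?_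
  simp only [density, Pi.one_apply, one_mul]
  rw [dbar_congr (hΦeq z hz)]
  obtain ⟨y, hy, rfl⟩ := hz
  have e5 := D.sec_symm_eventuallyEq hy
  have e6 := e5.self_of_nhds
  simp only at e6
  rw [dlog, logDeriv_apply, logDeriv_apply, e5.deriv_eq, e6]

/-- The only possible pole is the centre `x`, and there `φ` is locally constant, so the density
vanishes nearby. -/
theorem continuousAt_density {ψ φ : X → ℂ} {x y : X} (hy : y ∈ D.dom x)
    (hψ : ContDiffAt ℝ 1 (fun w => ψ ((chartAt ℂ x).symm w)) (chartAt ℂ x y))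
    (hφ : ContDiffAt ℝ 1 (fun w => φ ((chartAt ℂ x).symm w)) (chartAt ℂ x y))
    (h1 : D.ord x ≠ 0 → ∀ᶠ w in 𝓝 x, φ w = φ x) :
    ContinuousAt (D.density ψ φ x) (chartAt ℂ x y) := by
  by_cases h : y = x → D.ord x = 0
  · refine (hψ.continuousAt.mul (continuousAt_dbar hφ)).mul ?_
    refine ((D.analyticAt_sec hy).deriv.continuousAt).div (D.analyticAt_sec hy).continuousAt ?_
    rw [(chartAt ℂ x).left_inv (D.dom_subset x hy)]
    exact D.sec_ne_zero hy h
  · push Not at h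
    obtain ⟨rfl, h0⟩ := h
    have : D.density ψ φ y =ᶠ[𝓝 (chartAt ℂ y y)] fun _ => 0 := by
      filter_upwards [(eventually_chartAt_symm (mem_chart_source ℂ y) (h1 h0)).eventually_nhds]
        with z hz
      have hz' : (fun w => φ ((chartAt ℂ y).symm w)) =ᶠ[𝓝 z] fun _ => φ y := hz
      rw [density, dbar_congr hz', dbar_const]
      simp
    exact continuousAt_const.congr this.symm

theorem dbar_symm_eq_zero {φ : X → ℂ} {x y : X} (hy : y ∈ (chartAt ℂ x).source)
    (h : y ∉ tsupport φ) : dbar (fun w => φ ((chartAt ℂ x).symm w)) (chartAt ℂ x y) = 0 := by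
  have : (fun w => φ ((chartAt ℂ x).symm w)) =ᶠ[𝓝 (chartAt ℂ x y)] fun _ => 0 :=
    eventually_chartAt_symm hy (notMem_tsupport_iff_eventuallyEq.1 h)
  rw [dbar_congr this, dbar_const]

theorem integrableOn_density [CompactSpace X] {ψ φ : X → ℂ} {x : X}
    (hψ : ∀ y ∈ D.dom x, ContDiffAt ℝ 1 (fun w => ψ ((chartAt ℂ x).symm w)) (chartAt ℂ x y))
    (hφ : ∀ y ∈ D.dom x, ContDiffAt ℝ 1 (fun w => φ ((chartAt ℂ x).symm w)) (chartAt ℂ x y))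
    (h1 : D.ord x ≠ 0 → ∀ᶠ w in 𝓝 x, φ w = φ x)
    (hs : tsupport ψ ⊆ D.dom x ∨ tsupport φ ⊆ D.dom x) :
    IntegrableOn (D.density ψ φ x) (chartAt ℂ x '' D.dom x) := by
  obtain ⟨T, hT, hTs, hT0⟩ : ∃ T : Set X, IsClosed T ∧ T ⊆ D.dom x ∧
      ∀ y ∈ D.dom x, y ∉ T → D.density ψ φ x (chartAt ℂ x y) = 0 := by
    rcases hs with hs | hs
    · refine ⟨_, isClosed_tsupport ψ, hs, fun y hy hyT => ?_⟩
      rw [density, (chartAt ℂ x).left_inv (D.dom_subset x hy), image_eq_zero_of_notMem_tsupport hyT]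
      simp
    · refine ⟨_, isClosed_tsupport φ, hs, fun y hy hyT => ?_⟩
      rw [density, dbar_symm_eq_zero (D.dom_subset x hy) hyT]
      simp
  have hVo : IsOpen (chartAt ℂ x '' D.dom x) :=
    isOpen_chartAt_image (D.isOpen_dom x) (D.dom_subset x)
  have hK : IsCompact (chartAt ℂ x '' T) := hT.isCompact.image_of_continuousOn
    ((chartAt ℂ x).continuousOn.mono (hTs.trans (D.dom_subset x)))
  have hKint : IntegrableOn (D.density ψ φ x) (chartAt ℂ x '' T) := by
    refine ContinuousOn.integrableOn_compact hK ?_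
    rintro _ ⟨y, hy, rfl⟩
    exact (D.continuousAt_density (hTs hy) (hψ y (hTs hy)) (hφ y (hTs hy))
      h1).continuousWithinAt
  refine hKint.of_forall_sdiff_eq_zero hVo.measurableSet ?_
  rintro _ ⟨⟨y, hy, rfl⟩, hyT⟩
  exact hT0 y hy fun h => hyT ⟨y, h, rfl⟩

/-! ### Degree zero: flat sections have no zeros -/

/-- A partition of unity by complex-valued functions, subordinate to the domains of a flat section
and locally constant near its zeros. -/
theorem exists_partition [CompactSpace X] [T2Space X] [IsManifold 𝓘(ℂ) ω X] :
    ∃ (t : Finset X) (P : X → X → ℂ),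
      (∀ i x, ∀ y ∈ (chartAt ℂ x).source,
        ContDiffAt ℝ 1 (fun w => P i ((chartAt ℂ x).symm w)) (chartAt ℂ x y)) ∧
      (∀ i, tsupport (P i) ⊆ D.dom i) ∧ (∀ y, ∑ i ∈ t, P i y = 1) ∧
      (∀ x, D.ord x ≠ 0 → ∀ᶠ y in 𝓝 x, P x y = 1) ∧
      (∀ x, D.ord x ≠ 0 → ∀ i, ∀ᶠ y in 𝓝 x, P i y = P i x) ∧
      ∀ y, ∃ i ∈ t, y ∈ D.dom i := by
  have := isManifold_real_of_complex (X := X)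
  obtain ⟨ρ, hρ⟩ := SmoothPartitionOfUnity.exists_isSubordinate 𝓘(ℝ, ℂ) isClosed_univ D.dom
    D.isOpen_dom fun x _ => mem_iUnion_of_mem x (D.mem_dom x)
  have hfin := ρ.locallyFinite.finite_nonempty_of_compact
  have hsum : ∀ y, ∑ i ∈ hfin.toFinset, ρ i y = 1 := by
    intro y
    rw [← ρ.sum_eq_one (mem_univ y), finsum_eq_sum_of_support_subset]
    intro i hi
    exact hfin.mem_toFinset.2 ⟨y, hi⟩
  have htsupp : ∀ i, tsupport (fun y => (ρ i y : ℂ)) ⊆ tsupport (ρ i) := fun i =>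
    closure_mono fun y hy => by simpa using hy
  -- By `eq_of_mem_dom` a zero `x` belongs only to `dom x`, so all other members of the partition
  -- vanish near it.
  have hzero : ∀ x, D.ord x ≠ 0 → ∀ᶠ y in 𝓝 x, ∀ i, i ≠ x → ρ i y = 0 := by
    intro x hx
    filter_upwards [ρ.eventually_fintsupport_subset x] with y hy i hix
    by_contra h
    have h2 := hy ((ρ.mem_fintsupport_iff y i).2 (subset_tsupport _ h))
    exact hix (D.eq_of_mem_dom hx (hρ i ((ρ.mem_fintsupport_iff x i).1 h2))).symm
  have hone : ∀ x, D.ord x ≠ 0 → ∀ᶠ y in 𝓝 x, ρ x y = 1 := by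
    intro x hx
    filter_upwards [hzero x hx] with y hy
    rw [← ρ.sum_eq_one (mem_univ y), finsum_eq_single _ x hy]
  refine ⟨hfin.toFinset, fun i y => (ρ i y : ℂ), fun i x y hy => ?_, fun i => (htsupp i).trans (hρ i),
    fun y => by simpa using congrArg ofReal (hsum y), fun x hx => ?_, fun x hx i => ?_, fun y => ?_⟩
  · exact contDiffAt_chartAt_symm (φ := fun y => (ρ i y : ℂ))
      (ofRealCLM.contDiff.contMDiff.comp (ρ i).contMDiff) hy
  · filter_upwards [hone x hx] with y hy
    simp [hy]
  · by_cases hix : i = x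
    · subst hix
      filter_upwards [hone i hx] with y hy
      rw [hy, (hone i hx).self_of_nhds]
    · filter_upwards [hzero x hx] with y hy
      rw [hy i hix, (hzero x hx).self_of_nhds i hix]
  · obtain ⟨i, hi⟩ := ρ.exists_pos_of_mem (mem_univ y)
    have hi' : y ∈ Function.support (ρ i) := hi.ne'
    exact ⟨i, hfin.mem_toFinset.2 ⟨y, hi'⟩, hρ i (subset_tsupport _ hi')⟩

/-- A holomorphic section of a flat line bundle on a compact Riemann surface has no zeros, unless it
vanishes identically. -/
theorem ord_eq_zero [CompactSpace X] [T2Space X] [IsManifold 𝓘(ℂ) ω X] (x : X) : D.ord x = 0 := by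
  obtain ⟨t, P, hP, hs, hsum, hone, hloc, hcov⟩ := D.exists_partition
  have hVm : ∀ x, MeasurableSet (chartAt ℂ x '' D.dom x) := fun x =>
    (isOpen_chartAt_image (D.isOpen_dom x) (D.dom_subset x)).measurableSet
  have hPd : ∀ i x, ∀ y ∈ D.dom x,
      ContDiffAt ℝ 1 (fun w => P i ((chartAt ℂ x).symm w)) (chartAt ℂ x y) :=
    fun i x y hy => hP i x y (D.dom_subset x hy)
  have hsub : ∀ i j, chartAt ℂ i '' (D.dom i ∩ D.dom j) ⊆ chartAt ℂ i '' D.dom i := fun i j =>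
    image_mono inter_subset_left
  -- The weights `P j` localize the integrals: this integrand lives on the overlap of the two
  -- domains, so either chart may be used.
  have hexch : ∀ i j, ∫ z in chartAt ℂ i '' D.dom i, D.density (P j) (P i) i z =
      ∫ z in chartAt ℂ j '' D.dom j, D.density (P j) (P i) j z := by
    intro i j
    rw [setIntegral_eq_of_subset_of_forall_sdiff_eq_zero (hVm i) (hsub i j),
      setIntegral_eq_of_subset_of_forall_sdiff_eq_zero (hVm j) (hsub j i),
      inter_comm (D.dom j), D.setIntegral_density_eq fun y hy =>
        (hPd i j y hy).differentiableAt one_ne_zero]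
    · rintro _ ⟨⟨y, hy, rfl⟩, h⟩
      have : y ∉ tsupport (P i) := fun h' => h ⟨y, ⟨hy, hs i h'⟩, rfl⟩
      rw [density, dbar_symm_eq_zero (D.dom_subset j hy) this]
      simp
    · rintro _ ⟨⟨y, hy, rfl⟩, h⟩
      have : y ∉ tsupport (P j) := fun h' => h ⟨y, ⟨hy, hs j h'⟩, rfl⟩
      rw [density, (chartAt ℂ i).left_inv (D.dom_subset i hy),
        image_eq_zero_of_notMem_tsupport this]
      simp
  choose κ hκ hint using fun i => D.exists_integral_density_one (φ := P i) (x := i)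
    (hPd i i) (hs i) (hone i)
  have hleft : ∀ i, ∫ z in chartAt ℂ i '' D.dom i, D.density 1 (P i) i z =
      ∑ j ∈ t, ∫ z in chartAt ℂ i '' D.dom i, D.density (P j) (P i) i z := by
    intro i
    rw [← integral_finsetSum _ fun j _ => D.integrableOn_density (hPd j i) (hPd i i)
      (fun h => hloc i h i) (Or.inr (hs i))]
    congr 1
    ext z
    simp only [density, ← Finset.sum_mul, hsum, Pi.one_apply]
  -- In the fixed chart at `j`, summing over `i` brings in ∑ ∂̄P_i = ∂̄1 = 0.
  have hright : ∀ j, ∑ i ∈ t, ∫ z in chartAt ℂ j '' D.dom j, D.density (P j) (P i) j z = 0 := by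
    intro j
    rw [← integral_finsetSum _ fun i _ => D.integrableOn_density (hPd j j) (hPd i j)
      (fun h => hloc j h i) (Or.inl (hs j))]
    refine setIntegral_eq_zero_of_forall_eq_zero ?_
    rintro _ ⟨y, hy, rfl⟩
    simp only [density, ← Finset.sum_mul, ← Finset.mul_sum]
    have : ∑ i ∈ t, dbar (fun w => P i ((chartAt ℂ j).symm w)) (chartAt ℂ j y) = 0 := by
      rw [← dbar_sum t fun i _ => (hPd i j y hy).differentiableAt one_ne_zero]
      simp only [hsum, dbar_const]
    rw [this]
    simp
  have htot : ∑ i ∈ t, -((D.ord i : ℂ) * κ i) = 0 := by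
    calc ∑ i ∈ t, -((D.ord i : ℂ) * κ i) = ∑ i ∈ t, ∑ j ∈ t,
          ∫ z in chartAt ℂ j '' D.dom j, D.density (P j) (P i) j z :=
          Finset.sum_congr rfl fun i _ => by
            rw [← hint, hleft]
            exact Finset.sum_congr rfl fun j _ => hexch i j
      _ = 0 := ?_
    rw [Finset.sum_comm]
    exact Finset.sum_eq_zero fun j _ => hright j
  have htot' : ∑ i ∈ t, (D.ord i : ℝ) * κ i = 0 := by
    rw [Finset.sum_neg_distrib, neg_eq_zero] at htot
    exact_mod_cast htot
  obtain ⟨i, hi, hxi⟩ := hcov x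
  by_contra hx
  obtain rfl := D.eq_of_mem_dom hx hxi
  have := (Finset.sum_eq_zero_iff_of_nonneg fun i _ =>
    mul_nonneg (Nat.cast_nonneg (D.ord i)) (hκ i).le).1 htot' x hi
  rcases mul_eq_zero.1 this with h | h
  · exact hx (by exact_mod_cast h)
  · exact (hκ x).ne' h

end FlatSection

end ChartedSpace

/-! ### Holomorphic inverses, coverings and the identity theorem -/

/-- The inverse of a holomorphic homeomorphism between open subsets of `ℂ` is holomorphic. -/
theorem OpenPartialHomeomorph.differentiableAt_symm_of_differentiableOn
    (g : OpenPartialHomeomorph ℂ ℂ) (hg : DifferentiableOn ℂ g g.source) {w : ℂ}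
    (hw : w ∈ g.target) : DifferentiableAt ℂ g.symm w := by
  have hz := g.map_target hw
  have han : AnalyticAt ℂ g (g.symm w) := hg.analyticAt (g.open_source.mem_nhds hz)
  -- Critical points are isolated, since otherwise `g` would be constant on a disc, against
  -- injectivity.
  have hne : ∀ᶠ v in 𝓝[≠] (g.symm w), deriv g v ≠ 0 := by
    refine han.deriv.eventually_eq_zero_or_eventually_ne_zero.resolve_left fun h => ?_
    obtain ⟨r, hr, hball⟩ := Metric.eventually_nhds_iff_ball.1
      (h.and (g.open_source.mem_nhds hz))
    obtain ⟨a, ha⟩ := Metric.isOpen_ball.exists_is_const_of_deriv_eq_zero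
      (convex_ball (g.symm w) r).isPreconnected (hg.mono fun v hv => (hball v hv).2)
      fun v hv => (hball v hv).1
    have h1 : g.symm w ∈ Metric.ball (g.symm w) r := Metric.mem_ball_self hr
    have h2 : g.symm w + (r / 2 : ℝ) ∈ Metric.ball (g.symm w) r := by
      rw [Metric.mem_ball, dist_eq_norm, add_sub_cancel_left, norm_real, Real.norm_eq_abs,
        abs_of_pos (half_pos hr)]
      exact half_lt_self hr
    have := g.injOn (hball _ h1).2 (hball _ h2).2 ((ha _ h1).trans (ha _ h2).symm)
    have hr0 : (r / 2 : ℝ) = 0 := by exact_mod_cast (left_eq_add.1 this)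
    linarith
  have hcont := g.symm.continuousAt hw
  -- Off the isolated critical value the inverse function theorem applies; continuity removes the
  -- remaining singularity.
  refine (analyticAt_of_differentiable_on_punctured_nhds_of_continuousAt ?_ hcont).differentiableAt
  have htend : Tendsto g.symm (𝓝[≠] w) (𝓝[≠] (g.symm w)) := by
    refine tendsto_nhdsWithin_iff.2 ⟨hcont.tendsto.mono_left nhdsWithin_le_nhds, ?_⟩
    filter_upwards [self_mem_nhdsWithin,
      mem_nhdsWithin_of_mem_nhds (g.open_target.mem_nhds hw)] with v hv hvt h
    exact hv (g.symm.injOn hvt hw h)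
  filter_upwards [htend.eventually hne,
    mem_nhdsWithin_of_mem_nhds (g.open_target.mem_nhds hw)] with v hv hvt
  exact (g.hasDerivAt_symm hvt hv
    (hg.differentiableAt (g.open_source.mem_nhds (g.map_target hvt))).hasDerivAt).differentiableAt

/-- The image is open, and it is closed because an empty fibre stays empty throughout a trivializing
neighbourhood. -/
theorem IsCoveringMap.surjective_of_connectedSpace {E B : Type*} [TopologicalSpace E]
    [TopologicalSpace B] [Nonempty E] [ConnectedSpace B] {p : E → B} (hp : IsCoveringMap p) :
    Function.Surjective p := by
  have hclosed : IsClosed (range p) := by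
    rw [← isOpen_compl_iff, isOpen_iff_mem_nhds]
    intro x hx
    obtain ⟨_, U, hxU, hU, _, H, hH⟩ := hp x
    filter_upwards [hU.mem_nhds hxU] with x' hx'
    rintro ⟨y, rfl⟩
    exact hx ⟨_, (H ⟨y, hx'⟩).2.2⟩
  exact range_eq_univ.1 (IsClopen.eq_univ ⟨hclosed, hp.isLocalHomeomorph.isOpenMap.isOpen_range⟩
    (range_nonempty p))

section Holomorphic

variable {Y : Type*} [TopologicalSpace Y] [ChartedSpace ℂ Y] [IsManifold 𝓘(ℂ) ω Y] {f : Y → ℂ}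

theorem MDifferentiable.differentiableAt_chartAt_symm (hf : MDifferentiable 𝓘(ℂ) 𝓘(ℂ) f) (y : Y)
    {z : ℂ} (hz : z ∈ (chartAt ℂ y).target) :
    DifferentiableAt ℂ (fun w => f ((chartAt ℂ y).symm w)) z :=
  ((hf _).comp z (mdifferentiableAt_atlas_symm (chart_mem_atlas ℂ y) hz)).differentiableAt

theorem MDifferentiable.analyticAt_chartAt_symm (hf : MDifferentiable 𝓘(ℂ) 𝓘(ℂ) f) (y : Y) :
    AnalyticAt ℂ (fun w => f ((chartAt ℂ y).symm w)) (chartAt ℂ y y) :=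
  DifferentiableOn.analyticAt
    (fun _ hz => (hf.differentiableAt_chartAt_symm y hz).differentiableWithinAt)
    ((chartAt ℂ y).open_target.mem_nhds (mem_chart_target ℂ y))

/-- The identity theorem: a nonconstant holomorphic function does not vanish identically near any
point. -/
theorem MDifferentiable.not_eventually_eq_zero [PreconnectedSpace Y]
    (hf : MDifferentiable 𝓘(ℂ) 𝓘(ℂ) f) (hne : ∃ y, f y ≠ 0) (y : Y) :
    ¬ ∀ᶠ w in 𝓝 y, f w = 0 := by
  intro hy
  set S : Set Y := {y | ∀ᶠ w in 𝓝 y, f w = 0} with hS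
  have hopen : IsOpen S := isOpen_setOfPred_eventually_nhds
  have hclosed : IsClosed S := by
    rw [← closure_subset_iff_isClosed]
    intro v hv
    have hpull : ∀ {q : ℂ → Prop}, (∀ᶠ z in 𝓝 (chartAt ℂ v v), q z) →
        ∀ᶠ w in 𝓝 v, q (chartAt ℂ v w) := fun h =>
      ((chartAt ℂ v).continuousAt (mem_chart_source ℂ v)).eventually h
    have hsrc := (chartAt ℂ v).open_source.mem_nhds (mem_chart_source ℂ v)
    rcases (hf.analyticAt_chartAt_symm v).eventually_eq_zero_or_eventually_ne_zero with h | h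
    · filter_upwards [hpull h, hsrc] with w hw hws
      rwa [(chartAt ℂ v).left_inv hws] at hw
    · rw [eventually_nhdsWithin_iff] at h
      obtain ⟨w, ⟨hw, hws⟩, hwS⟩ := mem_closure_iff_nhds.1 hv _ ((hpull h).and hsrc)
      rw [(chartAt ℂ v).left_inv hws] at hw
      by_cases hwv : w = v
      · rwa [← hwv]
      · exact absurd (show ∀ᶠ u in 𝓝 w, f u = 0 from hwS).self_of_nhds
          (hw fun e => hwv ((chartAt ℂ v).injOn hws (mem_chart_source ℂ v) e))
  obtain ⟨v, hv⟩ := hne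
  have : v ∈ S := by
    rw [IsClopen.eq_univ ⟨hclosed, hopen⟩ ⟨y, hy⟩]
    trivial
  exact hv (show ∀ᶠ u in 𝓝 v, f u = 0 from this).self_of_nhds

/-- A holomorphic function, read through a local inverse of a holomorphic local homeomorphism, is
holomorphic in charts of the base. -/
theorem analyticAt_comp_symm_chartAt_symm {X : Type*} [TopologicalSpace X] [ChartedSpace ℂ X]
    [IsManifold 𝓘(ℂ) ω X] (e : OpenPartialHomeomorph Y X) (he : MDifferentiable 𝓘(ℂ) 𝓘(ℂ) e)
    (hf : MDifferentiable 𝓘(ℂ) 𝓘(ℂ) f) {x : X} (hx : x ∈ e.target) :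
    AnalyticAt ℂ (fun w => f (e.symm ((chartAt ℂ x).symm w))) (chartAt ℂ x x) := by
  set y := e.symm x
  set g : OpenPartialHomeomorph ℂ ℂ := ((chartAt ℂ y).symm.trans e).trans (chartAt ℂ x) with hg
  have hgd : DifferentiableOn ℂ g g.source := by
    intro z hz
    have hz1 : z ∈ (chartAt ℂ y).target := hz.1.1
    have hz2 : e ((chartAt ℂ y).symm z) ∈ (chartAt ℂ x).source := hz.2
    have h1 := (he _).comp z (mdifferentiableAt_atlas_symm (I := 𝓘(ℂ)) (chart_mem_atlas ℂ y) hz1)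
    have h2 := (mdifferentiableAt_atlas (I := 𝓘(ℂ)) (chart_mem_atlas ℂ x) hz2).comp z h1
    exact h2.differentiableAt.differentiableWithinAt
  have hxg : chartAt ℂ x x ∈ g.target := by
    simp [hg, y, hx]
  refine DifferentiableOn.analyticAt (s := g.target) (fun w hw => ?_) (g.open_target.mem_nhds hxg)
  have h1 := g.differentiableAt_symm_of_differentiableOn hgd hw
  have hwt : g.symm w ∈ (chartAt ℂ y).target := (g.map_target hw).1.1
  have h2 : DifferentiableAt ℂ (fun w => f ((chartAt ℂ y).symm (g.symm w))) w :=
    (hf.differentiableAt_chartAt_symm y hwt).comp w h1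
  refine (h2.congr_of_eventuallyEq ?_).differentiableWithinAt
  filter_upwards [g.open_target.mem_nhds hw] with v hv
  have hv1 : e.symm ((chartAt ℂ x).symm v) ∈ (chartAt ℂ y).source := by
    have := hv
    simp only [hg, OpenPartialHomeomorph.trans_target, mem_inter_iff, mem_preimage,
      OpenPartialHomeomorph.symm_target] at this
    exact this.2.2
  change _ = f ((chartAt ℂ y).symm (chartAt ℂ y (e.symm ((chartAt ℂ x).symm v))))
  rw [(chartAt ℂ y).left_inv hv1]

end Holomorphic

/-! ### Deck transformations and automorphic functions -/

section UniversalCover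

variable {X Y : Type*} [TopologicalSpace X] [ChartedSpace ℂ X] [TopologicalSpace Y]
  [ChartedSpace ℂ Y] {p : Y → X}

/-- The deck group of the universal cover acts transitively on fibres. -/
theorem IsUniversalCover.exists_deck (hp : IsUniversalCover p) {y y' : Y} (h : p y = p y') :
    ∃ γ : DeckGroup p, γ.1 y = y' := by
  have := hp.simplyConnected
  have := ChartedSpace.locallyPathConnectedSpace ℂ Y
  have hc := hp.isCoveringMap
  have lift : ∀ a b : Y, p a = p b → ∃ F : C(Y, Y), F a = b ∧ p ∘ F = p := fun a b hab => by
    obtain ⟨F, hF, -⟩ := hc.existsUnique_continuousMap_lifts ⟨p, hc.continuous⟩ a b hab.symm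
    exact ⟨F, hF⟩
  -- Both G ∘ F and the identity lift `p` and agree at `a`, so uniqueness of lifts identifies them.
  have inv : ∀ (a b : Y) (F G : C(Y, Y)), F a = b → G b = a → p ∘ F = p → p ∘ G = p →
      ∀ u, G (F u) = u := by
    intro a b F G hF hG hpF hpG u
    have e : p ∘ (G ∘ F) = p ∘ id := by
      rw [← Function.comp_assoc, hpG, hpF, Function.comp_id]
    exact congrFun (hc.eq_of_comp_eq (G.continuous.comp F.continuous) continuous_id e a
      (by simp [hF, hG])) u
  obtain ⟨F, hF, hpF⟩ := lift y y' h
  obtain ⟨G, hG, hpG⟩ := lift y' y h.symm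
  exact ⟨⟨⟨⟨F, G, inv y y' F G hF hG hpF hpG, inv y' y G F hG hF hpG hpF⟩, F.continuous,
    G.continuous⟩, fun u => congrFun hpF u⟩, hF⟩

/-- On the universal cover of a compact Riemann surface, a holomorphic function that is
multiplicatively automorphic, and not identically zero, has no zeros. -/
theorem IsUniversalCover.ne_zero_of_automorphic [T2Space X] [CompactSpace X] [ConnectedSpace X]
    [IsManifold 𝓘(ℂ) ω X] [ConnectedSpace Y] [IsManifold 𝓘(ℂ) ω Y] (hp : IsUniversalCover p)
    {f : Y → ℂ} (hf : MDifferentiable 𝓘(ℂ) 𝓘(ℂ) f) (hne : ∃ y, f y ≠ 0)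
    {a : DeckGroup p → ℂ} (ha : ∀ γ, a γ ≠ 0)
    (haut : ∀ (γ : DeckGroup p) (y : Y), f (γ.1 y) = a γ * f y) (y : Y) : f y ≠ 0 := by
  choose s hs using hp.isCoveringMap.surjective_of_connectedSpace
  choose e hes hep using fun x => hp.isCoveringMap.isLocalHomeomorph (s x)
  have hmem : ∀ x, x ∈ (e x).target := fun x => by
    have := (e x).map_source (hes x)
    rwa [← hep x, hs] at this
  have hex : ∀ x, (e x).symm x = s x := fun x => by
    have := (e x).left_inv (hes x)
    rwa [← hep x, hs] at this
  have hpe : ∀ x, ∀ w ∈ (e x).target, p ((e x).symm w) = w := fun x w hw => by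
    rw [hep x]
    exact (e x).right_inv hw
  have han : ∀ x, AnalyticAt ℂ (fun w => f ((e x).symm ((chartAt ℂ x).symm w))) (chartAt ℂ x x) :=
    fun x => analyticAt_comp_symm_chartAt_symm (e x) (hep x ▸ hp.holomorphic) hf (hmem x)
  have hnz : ∀ x, ¬ ∀ᶠ w in 𝓝 (chartAt ℂ x x), f ((e x).symm ((chartAt ℂ x).symm w)) = 0 := by
    intro x h
    refine hf.not_eventually_eq_zero hne (s x) ?_
    have hc1 : ContinuousAt (fun v => chartAt ℂ x (p v)) (s x) := by
      refine ContinuousAt.comp ?_ hp.isCoveringMap.continuous.continuousAt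
      rw [hs]
      exact (chartAt ℂ x).continuousAt (mem_chart_source ℂ x)
    have h' : ∀ᶠ w in 𝓝 (chartAt ℂ x (p (s x))), f ((e x).symm ((chartAt ℂ x).symm w)) = 0 := by
      rwa [hs]
    filter_upwards [hc1.eventually h', (e x).open_source.mem_nhds (hes x),
      hp.isCoveringMap.continuous.continuousAt.preimage_mem_nhds
        ((chartAt ℂ x).open_source.mem_nhds (by rw [hs]; exact mem_chart_source ℂ x))]
      with v hv hvs hvc
    rwa [(chartAt ℂ x).left_inv hvc, hep x, (e x).left_inv hvs] at hv
  choose n g hg hg0 hfg using fun x => (han x).exists_eventuallyEq_pow_smul_nonzero_iff.2 (hnz x)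
  have hev : ∀ x, ∀ᶠ y in 𝓝 x, (y ∈ (chartAt ℂ x).source ∧ y ∈ (e x).target) ∧
      AnalyticAt ℂ (g x) (chartAt ℂ x y) ∧ g x (chartAt ℂ x y) ≠ 0 ∧
      f ((e x).symm ((chartAt ℂ x).symm (chartAt ℂ x y))) =
        (chartAt ℂ x y - chartAt ℂ x x) ^ n x • g x (chartAt ℂ x y) := fun x =>
    (((chartAt ℂ x).open_source.eventually_mem (mem_chart_source ℂ x)).and
      ((e x).open_target.eventually_mem (hmem x))).and
      (((chartAt ℂ x).continuousAt (mem_chart_source ℂ x)).eventually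
        ((hg x).eventually_analyticAt.and
          (((hg x).continuousAt.eventually_ne (hg0 x)).and (hfg x))))
  choose U hU hUo hxU using fun x => eventually_nhds_iff.1 (hev x)
  -- Near `x` the section is `f` read on the sheet `e x` of `p`. Two sheets over a point differ
  -- locally by a deck transformation γ, so the ratio is the constant `a γ`.
  let D : FlatSection X :=
    { sec := fun x w => f ((e x).symm w)
      dom := U
      ord := n
      unit := g
      isOpen_dom := hUo
      mem_dom := hxU
      dom_subset := fun x w hw => (hU x w hw).1.1
      analyticAt_unit := fun x w hw => (hU x w hw).2.1
      unit_ne_zero := fun x w hw => (hU x w hw).2.2.1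
      sec_eq := fun x w hw => by
        have h := (hU x w hw).2.2.2
        rwa [(chartAt ℂ x).left_inv (hU x w hw).1.1, smul_eq_mul] at h
      proportional := fun x x' w hw hw' => by
        have ht := (hU x w hw).1.2
        have ht' := (hU x' w hw').1.2
        obtain ⟨γ, hγ⟩ := hp.exists_deck ((hpe x' w ht').trans (hpe x w ht).symm)
        refine ⟨a γ, ha γ, ?_⟩
        have hc : ContinuousAt (fun v => γ.1 ((e x').symm v)) w :=
          γ.1.continuous.continuousAt.comp ((e x').symm.continuousAt ht')
        filter_upwards [(e x).open_target.mem_nhds ht, (e x').open_target.mem_nhds ht',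
          hc.preimage_mem_nhds ((e x).open_source.mem_nhds
            (by rw [hγ]; exact (e x).map_target ht))] with v hv hv' hvs
        have : (e x).symm v = γ.1 ((e x').symm v) := by
          refine (e x).injOn ((e x).map_target hv) hvs ?_
          rw [← hep x, hpe x v hv, γ.2, hpe x' v hv']
        rw [this, haut] }
  have hD := D.sec_ne_zero (D.mem_dom (p y)) fun _ => D.ord_eq_zero (p y)
  obtain ⟨γ, hγ⟩ := hp.exists_deck (hs (p y))
  have hD' : f (s (p y)) ≠ 0 := by
    rw [← hex]
    exact hD
  rw [← hγ, haut]
  exact mul_ne_zero (ha γ) hD'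

end UniversalCover

/-! ### Logarithms, periods and fixed points of the holonomy -/

theorem AffineEquiv.complex_apply_sub (g : ℂ ≃ᵃ[ℂ] ℂ) (z w : ℂ) :
    g z - g w = g.linear 1 * (z - w) := by
  have h1 := g.toAffineMap.linearMap_vsub z w
  have h2 := g.linear.map_smul (z - w) 1
  simp only [smul_eq_mul, mul_one] at h2
  rw [mul_comm, ← h2]
  exact h1.symm

theorem AffineEquiv.complex_linear_one_ne_zero (g : ℂ ≃ᵃ[ℂ] ℂ) : g.linear 1 ≠ 0 := fun h =>
  one_ne_zero (g.linear.map_eq_zero_iff.1 h)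

/-- If `exp h` is multiplicatively automorphic, then `h` is additively automorphic. -/
theorem exists_period_of_exp_automorphic {X Y : Type*} [TopologicalSpace Y]
    [ConnectedSpace Y] {p : Y → X} {h : Y → ℂ} (hc : Continuous h)
    {a : DeckGroup p → ℂ}
    (haut : ∀ (γ : DeckGroup p) (y : Y), exp (h (γ.1 y)) = a γ * exp (h y)) :
    ∃ c : DeckGroup p → ℂ, ∀ (γ : DeckGroup p) (y : Y), h (γ.1 y) = h y + c γ := by
  obtain ⟨y₀⟩ : Nonempty Y := inferInstance
  refine ⟨fun γ => h (γ.1 y₀) - h y₀, fun γ y => ?_⟩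
  have hcont : Continuous fun y => h (γ.1 y) - h y := (hc.comp γ.1.continuous).sub hc
  -- The difference is a continuous lift of a constant through the covering `exp`, hence constant on
  -- connected `Y`.
  have := isCoveringMap_exp.const_of_comp hcont (fun u v => by
    simp only [exp_sub, haut, mul_div_cancel_right₀ _ (exp_ne_zero _)]) y y₀
  linear_combination this

namespace IsUniversalCover

variable {X Y : Type*} [TopologicalSpace X] [ChartedSpace ℂ X] [TopologicalSpace Y]
  [ChartedSpace ℂ Y] {p : Y → X}

/-- A nowhere vanishing holomorphic function on the universal cover has a holomorphic logarithm. -/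
theorem exists_exp_eq [ConnectedSpace Y] (hp : IsUniversalCover p) {f : Y → ℂ}
    (hf : MDifferentiable 𝓘(ℂ) 𝓘(ℂ) f) (h0 : ∀ y, f y ≠ 0) :
    ∃ h : Y → ℂ, MDifferentiable 𝓘(ℂ) 𝓘(ℂ) h ∧ ∀ y, exp (h y) = f y := by
  have := hp.simplyConnected
  have := ChartedSpace.locallyPathConnectedSpace ℂ Y
  obtain ⟨y₀⟩ : Nonempty Y := inferInstance
  obtain ⟨h, ⟨-, hh⟩, -⟩ := isCoveringMapOn_exp.existsUnique_continuousMap_lifts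
    ⟨f, hf.continuous⟩ (a₀ := y₀) (exp_log (h0 y₀)) h0
  have hexp : ∀ y, exp (h y) = f y := fun y => congrFun hh y
  refine ⟨h, fun y => ?_, hexp⟩
  -- Near `y` the continuous lift must equal this branch of the logarithm, because the imaginary
  -- part of its increment stays within (-π, π).
  have hlog : DifferentiableAt ℂ (fun w => h y + log (w / f y)) (f y) := by
    refine (DifferentiableAt.clog (by fun_prop) ?_).const_add _
    rw [div_self (h0 y)]
    exact one_mem_slitPlane
  have hcomp : MDifferentiableAt 𝓘(ℂ) 𝓘(ℂ) (fun w => h y + log (f w / f y)) y :=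
    hlog.mdifferentiableAt.comp y (hf y)
  refine hcomp.congr_of_eventuallyEq ?_
  have him : Tendsto (fun w => (h w - h y).im) (𝓝 y) (𝓝 0) := by
    have : Continuous fun w => (h w - h y).im := by fun_prop
    simpa using this.tendsto y
  filter_upwards [him (Ioo_mem_nhds (neg_neg_of_pos Real.pi_pos) Real.pi_pos)] with w hw
  rw [← hexp, ← hexp, ← exp_sub, log_exp hw.1 (le_of_lt hw.2)]
  ring

variable [T2Space X] [CompactSpace X] [ConnectedSpace X] [IsManifold 𝓘(ℂ) ω X] [ConnectedSpace Y]
  [IsManifold 𝓘(ℂ) ω Y]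

/-- A developing map never takes a value fixed by the holonomy. -/
theorem dev_ne_of_fixed (hp : IsUniversalCover p) (A : BranchedAffineStructure p) {z₀ : ℂ}
    (hz : ∀ γ, A.hol γ z₀ = z₀) (y : Y) : A.dev y - z₀ ≠ 0 := by
  refine hp.ne_zero_of_automorphic (f := fun y => A.dev y - z₀)
    (a := fun γ => (A.hol γ).linear 1) ?_ ?_ (fun γ => (A.hol γ).complex_linear_one_ne_zero)
    (fun γ y => ?_) y
  · exact (differentiable_id.sub_const z₀).mdifferentiable.comp A.holomorphic
  · by_contra! h
    obtain ⟨u, v, huv⟩ := A.nonconstant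
    exact huv ((sub_eq_zero.1 (h u)).trans (sub_eq_zero.1 (h v)).symm)
  · rw [A.equivariant]
    conv_lhs => rw [← hz γ]
    exact (A.hol γ).complex_apply_sub _ _

/-- A translation with a fixed point is the identity, so the holonomy would fix the value `dev y₀`,
which `dev_ne_of_fixed` forbids. -/
theorem not_isTranslation_of_fixed (hp : IsUniversalCover p) (A : BranchedAffineStructure p)
    {z₀ : ℂ} (hz : ∀ γ, A.hol γ z₀ = z₀) : ¬ A.IsTranslation := by
  intro hA
  obtain ⟨y₀⟩ : Nonempty Y := inferInstance
  refine hp.dev_ne_of_fixed A (z₀ := A.dev y₀) (fun γ => ?_) y₀ (sub_self _)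
  obtain ⟨c, hc⟩ := hA γ
  have h := hz γ
  rw [hc, add_eq_left] at h
  rw [hc, h, add_zero]

/-- A branched affine structure whose holonomy has a fixed point is an exponential. -/
theorem exists_sameStructure_exp (hp : IsUniversalCover p) (A : BranchedAffineStructure p)
    {z₀ : ℂ} (hz : ∀ γ, A.hol γ z₀ = z₀) :
    ∃ T : TranslationStructure p, A.SameStructure T.exp := by
  obtain ⟨h, hh, hexp⟩ := hp.exists_exp_eq (f := fun y => A.dev y - z₀)
    ((differentiable_id.sub_const z₀).mdifferentiable.comp A.holomorphic) (hp.dev_ne_of_fixed A hz)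
  have haut : ∀ (γ : DeckGroup p) (y : Y),
      exp (h (γ.1 y)) = (A.hol γ).linear 1 * exp (h y) := fun γ y => by
    rw [hexp, hexp, A.equivariant]
    conv_lhs => rw [← hz γ]
    exact (A.hol γ).complex_apply_sub _ _
  obtain ⟨c, hc⟩ := exists_period_of_exp_automorphic hh.continuous haut
  obtain ⟨y₀⟩ : Nonempty Y := inferInstance
  have hone : c 1 = 0 := by
    have := hc 1 y₀
    exact left_eq_add.1 this
  have hmul : ∀ γ δ, c (γ * δ) = c γ + c δ := fun γ δ => by
    have h1 := hc (γ * δ) y₀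
    have h2 : h ((γ * δ).1 y₀) = h (γ.1 (δ.1 y₀)) := rfl
    rw [h2, hc γ, hc δ] at h1
    linear_combination -h1
  let T : TranslationStructure p :=
    { dev := h
      hol :=
        { toFun := fun γ => AffineEquiv.constVAdd ℂ ℂ (c γ)
          map_one' := by ext z; simp [hone]
          map_mul' := fun γ δ => by ext z; simp [hmul] }
      holomorphic := hh
      nonconstant := by
        by_contra! hcon
        obtain ⟨u, v, huv⟩ := A.nonconstant
        apply huv
        have : A.dev u - z₀ = A.dev v - z₀ := by rw [← hexp, ← hexp, hcon u v]
        exact sub_left_injective this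
      equivariant := fun γ y => by simp [hc, add_comm]
      isTranslation := fun γ => ⟨c γ, fun z => by simp [add_comm]⟩ }
  refine ⟨T, AffineEquiv.constVAdd ℂ ℂ z₀, fun y => ?_, fun γ => ?_⟩
  · change A.dev y = z₀ + exp (h y)
    rw [hexp]
    ring
  · have hlin : exp (c γ) = (A.hol γ).linear 1 := by
      have := haut γ y₀
      rw [hc, exp_add, mul_comm] at this
      exact mul_right_cancel₀ (exp_ne_zero _) this
    have hper : T.period γ = c γ := by
      simp [T, TranslationStructure.period]
    ext z
    have h1 := (A.hol γ).complex_apply_sub z z₀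
    rw [hz γ, ← hlin] at h1
    have h2 : A.hol γ z = z₀ + exp (c γ) * (z - z₀) := by linear_combination h1
    rw [h2, AffineEquiv.inv_def]
    simp [TranslationStructure.exp, AffineMap.homothety_apply, hper]
    ring

end IsUniversalCover

/-- Commuting affine maps of `ℂ`, not all of them translations, have a common fixed point. -/
theorem BranchedAffineStructure.exists_fixed {X Y : Type*} [TopologicalSpace Y]
    [ChartedSpace ℂ Y] {p : Y → X} (A : BranchedAffineStructure p) (hA : A.HasAbelianHolonomy)
    (h : ¬ A.IsTranslation) : ∃ z₀ : ℂ, ∀ γ, A.hol γ z₀ = z₀ := by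
  obtain ⟨δ, hδ⟩ := not_forall.1 h
  have hlin : 1 - (A.hol δ).linear 1 ≠ 0 := fun e => by
    refine hδ ⟨A.hol δ 0, fun z => ?_⟩
    have := (A.hol δ).complex_apply_sub z 0
    linear_combination this - z * e
  refine ⟨A.hol δ 0 / (1 - (A.hol δ).linear 1), fun γ => ?_⟩
  set z₀ := A.hol δ 0 / (1 - (A.hol δ).linear 1) with hz₀
  have hz : z₀ * (1 - (A.hol δ).linear 1) = A.hol δ 0 := div_mul_cancel₀ _ hlin
  have hfix : A.hol δ z₀ = z₀ := by
    have := (A.hol δ).complex_apply_sub z₀ 0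
    linear_combination this - hz
  -- By commutation γ sends the fixed point of δ to a fixed point of δ, and there is only one.
  have hcomm : A.hol δ (A.hol γ z₀) = A.hol γ z₀ := by
    have := congrArg (fun g : ℂ ≃ᵃ[ℂ] ℂ => g z₀) (hA δ γ)
    simpa only [AffineEquiv.mul_def, AffineEquiv.trans_apply, hfix] using this
  have := (A.hol δ).complex_apply_sub (A.hol γ z₀) z₀
  rw [hcomm, hfix] at this
  have h2 : (1 - (A.hol δ).linear 1) * (A.hol γ z₀ - z₀) = 0 := by linear_combination this
  exact sub_eq_zero.1 ((mul_eq_zero.1 h2).resolve_left hlin)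

end

theorem mainTheorem9 {X Y : Type*}
    [TopologicalSpace X] [T2Space X] [CompactSpace X] [ConnectedSpace X]
    [ChartedSpace ℂ X] [IsManifold 𝓘(ℂ) ω X]
    [TopologicalSpace Y] [ConnectedSpace Y] [ChartedSpace ℂ Y] [IsManifold 𝓘(ℂ) ω Y]
    (p : Y → X) (hp : IsUniversalCover p)
    (A : BranchedAffineStructure p) (hA : A.HasAbelianHolonomy) :
    (¬ A.IsTranslation ↔ ∃ z₀ : ℂ, ∀ γ, A.hol γ z₀ = z₀) ∧
      (¬ A.IsTranslation → ∃ T : TranslationStructure p, A.SameStructure T.exp) := by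
  refine ⟨⟨A.exists_fixed hA, fun ⟨_, hz⟩ => hp.not_isTranslation_of_fixed A hz⟩, fun h => ?_⟩
  obtain ⟨_, hz⟩ := A.exists_fixed hA h
  exact hp.exists_sameStructure_exp A hz
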